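/- Let $f : \mathbb{R} \to \mathbb{R}$ be a (real-valued) function in $L^1(\mathbb{R}) \cap L^2(\mathbb{R})$. Then $x \mapsto f(x) f(x+t)$ is integrable on $\mathbb{R}$ for every $t \in \mathbb{R}$, the function $t \mapsto \int_{\mathbb{R}} f(x) f(x+t)\,dx$ is integrable on $[-\frac12, \frac12]$, and $$ \int_{-\frac{1}{2}}^{\frac{1}{2}} \int_{\mathbb{R}} f(x) f(x+t)\,dx\,dt \;\le\; 0.91\, \|f\|_{L^1(\mathbb{R})} \|f\|_{L^2(\mathbb{R})}. $$ Moreover, the constant $0.91$ cannot be replaced by $0.8$: it is not true that $$ \int_{-\frac{1}{2}}^{\frac{1}{2}} \int_{\mathbb{R}} f(x) f(x+t)\,dx\,dt \;\le\; 0.8\, \|f\|_{L^1(\mathbb{R})} \|f\|_{L^2(\mathbb{R})} $$ for all real-valued $f \in L^1(\mathbb{R}) \cap L^2(\mathbb{R})$. -/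

import Mathlib

open MeasureTheory

open scoped FourierTransform ContDiff

/-! Passing to `|f|`, assume `f ≥ 0`; let `A` be its autocorrelation, `p = ‖f‖₁`, `q = ‖f‖₂`, and
`L` the integral of `A` over `[-1/2, 1/2]`. Then `L ≤ ∫ A = p²`, and `A ≤ q²` gives `L ≤ q²`. These
settle all ratios `p/q` away from 1. For `p/q` near 1, `A` is the cosine transform of the
nonnegative weight `‖𝓕 f‖²`, of total mass `q²`. The kernel inequality `integral_cos_half_le`,
integrated against this weight, yields `L ≤ q²/2 + 0.396 ∫_{-3/4}^{3/4} A ≤ q²/2 + 0.396 p²`;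
`le_of_three_bounds` combines the three. The constant 0.8 fails for a sum of four centred boxes,
where everything is explicit. -/

/-! ### Fourier transform on `L¹ ∩ L²` -/

/-- On `L¹ ∩ L²` the Fourier integral represents the `L²` Fourier transform. -/
lemma fourier_toLp_two_ae_eq {f : ℝ → ℂ} (h1 : Integrable f) (h2 : MemLp f 2 volume) :
    (𝓕 (h2.toLp f) : Lp ℂ 2 (volume : Measure ℝ)) =ᵐ[volume] 𝓕 f := by
  have hcont : Continuous (𝓕 f) :=
    VectorFourier.fourierIntegral_continuous Real.continuous_fourierChar
      (by exact continuous_inner) h1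
  refine ae_eq_of_integral_contDiff_smul_eq
    ((Lp.memLp _).locallyIntegrable (by norm_num)) hcont.locallyIntegrable ?_
  intro g hg hgs
  have hgs' : HasCompactSupport (fun x => (g x : ℂ)) := hgs.comp_left Complex.ofReal_zero
  have hg' : ContDiff ℝ ∞ (fun x => (g x : ℂ)) := Complex.ofRealCLM.contDiff.comp hg
  set G : SchwartzMap ℝ ℂ := hgs'.toSchwartzMap hg' with hG
  have hGx : ∀ x, G x = (g x : ℂ) := fun x => rfl
  -- Duality moves `𝓕` from the `L²` class onto the test function; `e3` moves it back onto the
  -- integrable `f`.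
  have e1 := DFunLike.congr_fun (Lp.fourier_toTemperedDistribution_eq (h2.toLp f)) G
  rw [TemperedDistribution.fourier_apply, Lp.toTemperedDistribution_apply,
    Lp.toTemperedDistribution_apply] at e1
  have e2 : ∫ x, (𝓕 G) x • (h2.toLp f) x = ∫ x, (𝓕 G) x • f x := by
    refine integral_congr_ae ?_
    filter_upwards [h2.coeFn_toLp] with x hx
    rw [hx]
  have e3 : ∫ x, 𝓕 (G : ℝ → ℂ) x • f x = ∫ x, G x • 𝓕 f x := by
    have := VectorFourier.integral_fourierIntegral_smul_eq_flip (L := innerₗ ℝ)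
      (μ := volume) (ν := volume)
      Real.continuous_fourierChar (by exact continuous_inner) (G.integrable (μ := volume)) h1
    rwa [flip_innerₗ] at this
  calc ∫ x, g x • (𝓕 (h2.toLp f) : Lp ℂ 2 (volume : Measure ℝ)) x
      = ∫ x, G x • (𝓕 (h2.toLp f) : Lp ℂ 2 (volume : Measure ℝ)) x := by
        simp [hGx]
    _ = ∫ x, 𝓕 (G : ℝ → ℂ) x • f x := by
        rw [← e1, e2]
        simp [SchwartzMap.fourier_coe]
    _ = ∫ x, g x • 𝓕 f x := by rw [e3]; simp [hGx]

lemma memLp_two_fourier {f : ℝ → ℂ} (h1 : Integrable f) (h2 : MemLp f 2 volume) :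
    MemLp (𝓕 f) 2 volume :=
  (memLp_congr_ae (fourier_toLp_two_ae_eq h1 h2)).1 (Lp.memLp _)

lemma integral_conj_mul_fourier {f g : ℝ → ℂ} (hf1 : Integrable f) (hf2 : MemLp f 2 volume)
    (hg1 : Integrable g) (hg2 : MemLp g 2 volume) :
    ∫ ξ, starRingEnd ℂ (𝓕 f ξ) * 𝓕 g ξ = ∫ x, starRingEnd ℂ (f x) * g x := by
  have h := Lp.inner_fourier_eq (hf2.toLp f) (hg2.toLp g)
  rw [L2.inner_def, L2.inner_def] at h
  have hl : ∫ ξ, starRingEnd ℂ (𝓕 f ξ) * 𝓕 g ξ =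
      ∫ a, inner ℂ ((𝓕 (hf2.toLp f) : Lp ℂ 2 (volume : Measure ℝ)) a)
        ((𝓕 (hg2.toLp g) : Lp ℂ 2 (volume : Measure ℝ)) a) := by
    refine integral_congr_ae ?_
    filter_upwards [fourier_toLp_two_ae_eq hf1 hf2, fourier_toLp_two_ae_eq hg1 hg2] with x h1 h2
    rw [h1, h2, RCLike.inner_apply, mul_comm]
  have hr : ∫ x, starRingEnd ℂ (f x) * g x =
      ∫ a, inner ℂ (hf2.toLp f a) (hg2.toLp g a) := by
    refine integral_congr_ae ?_
    filter_upwards [hf2.coeFn_toLp, hg2.coeFn_toLp] with x h1 h2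
    rw [h1, h2, RCLike.inner_apply, mul_comm]
  rw [hl, hr, h]

lemma fourier_comp_add_right (f : ℝ → ℂ) (t ξ : ℝ) :
    𝓕 (fun x => f (x + t)) ξ = Complex.exp (2 * Real.pi * t * ξ * Complex.I) * 𝓕 f ξ := by
  have h := congrFun (VectorFourier.fourierIntegral_comp_add_right Real.fourierChar
    (volume : Measure ℝ) (innerₗ ℝ) f t) ξ
  change 𝓕 (fun x => f (x + t)) ξ = _ at h
  have h' : VectorFourier.fourierIntegral Real.fourierChar volume (innerₗ ℝ) f ξ = 𝓕 f ξ := rfl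
  rw [h] 
  simp only [h', Circle.smul_def, Real.fourierChar_apply, smul_eq_mul]
  congr 2
  simp
  ring

/-! ### Kernel inequality and its constants -/

lemma sin_two_mul_sub_sin_three_mul_le {φ : ℝ} (h : 0 ≤ φ) :
    Real.sin (2 * φ) - 0.396 * Real.sin (3 * φ) ≤ φ := by
  by_cases h1 : 1.396 ≤ φ
  · have := Real.sin_le_one (2 * φ)
    have := Real.neg_one_le_sin (3 * φ)
    linarith
  push Not at h1
  have hs0 : 0 ≤ Real.sin φ := Real.sin_nonneg_of_nonneg_of_le_pi h (by linarith [Real.pi_gt_three])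
  have hs1 := Real.sin_le_one φ
  have hs2 := Real.sin_le h
  have hc := Real.one_sub_sq_div_two_le_cos (x := φ)
  have hc1 := Real.cos_le_one φ
  have e : Real.sin (2 * φ) - 0.396 * Real.sin (3 * φ) =
      Real.sin φ * (2 * Real.cos φ - 0.396 * (4 * Real.cos φ ^ 2 - 1)) := by
    rw [Real.sin_two_mul, Real.sin_three_mul]
    have := Real.sin_sq_add_cos_sq φ
    linear_combination (1.584 * Real.sin φ) * this
  rw [e]
  set u := Real.cos φ
  -- The quadratic peaks at `u = 1 / 1.584 ≈ 0.6313`. Its excess over 1 must be absorbed by the gap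
  -- between `sin φ` and `φ`, except for small `φ`, where `u` is near 1 and the factor is at most 1.
  have hG : 2 * u - 0.396 * (4 * u ^ 2 - 1) ≤ 1.0274 := by nlinarith [sq_nonneg (u - 0.6313)]
  by_cases h2 : 1.0274 ≤ φ
  · nlinarith
  push Not at h2
  by_cases h3 : φ ≤ 0.42
  · have hu : 0.91 ≤ u := by nlinarith
    have : 2 * u - 0.396 * (4 * u ^ 2 - 1) ≤ 1 := by nlinarith
    nlinarith
  push Not at h3
  by_cases h4 : 1 ≤ φ
  · have hs : Real.sin φ ≤ 0.9 := by
      have hc0 : 0.47 ≤ u := by nlinarith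
      nlinarith [Real.sin_sq_add_cos_sq φ]
    nlinarith
  push Not at h4
  have hs : Real.sin φ * 1.0274 ≤ φ := by
    have := Real.sin_bound (x := φ) (by rw [abs_le]; constructor <;> linarith)
    rw [abs_le, abs_of_nonneg h] at this
    -- `0.0267` exceeds `1 - 1 / 1.0274`.
    have h5 : 0.0267 ≤ φ ^ 2 / 6 - φ ^ 4 / 100 := by nlinarith
    have h6 : Real.sin φ ≤ φ * (1 - (φ ^ 2 / 6 - φ ^ 4 / 100)) := by linarith [this.2]
    nlinarith
  nlinarith

lemma integral_cos_mul (s : ℝ) {a : ℝ} (ha : a ≠ 0) :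
    ∫ t in (-s)..s, Real.cos (a * t) = 2 * Real.sin (a * s) / a := by
  rw [intervalIntegral.integral_comp_mul_left _ ha, integral_cos]
  simp
  field_simp
  ring

/-- With `φ = a / 4` and denominators cleared, this is `sin_two_mul_sub_sin_three_mul_le`. -/
lemma integral_cos_half_le (a : ℝ) :
    ∫ t in (-(1 / 2) : ℝ)..(1 / 2), Real.cos (a * t) ≤
      1 / 2 + 0.396 * ∫ t in (-(3 / 4) : ℝ)..(3 / 4), Real.cos (a * t) := by
  wlog ha : 0 ≤ a generalizing a
  · simpa using this (-a) (by linarith)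
  rcases ha.eq_or_lt with rfl | ha
  · norm_num
  rw [integral_cos_mul _ ha.ne', integral_cos_mul _ ha.ne']
  have h := sin_two_mul_sub_sin_three_mul_le (φ := a / 4) (by positivity)
  rw [show 2 * (a / 4) = a * (1 / 2) by ring, show 3 * (a / 4) = a * (3 / 4) by ring] at h
  rw [div_le_iff₀ ha, add_mul, mul_assoc, div_mul_cancel₀ _ ha.ne']
  linarith

/-- In the middle range `r = p / q` lies between `0.91` and `1 / 0.91`, where `0.396 r² - 0.91 r +
1/2 ≤ 0`. At `r = 0.91` this is nearly sharp: it allows a coefficient only up to about `0.3962`. -/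
lemma le_of_three_bounds {L p q : ℝ} (hp : 0 ≤ p) (hq : 0 ≤ q) (h1 : L ≤ p ^ 2) (h2 : L ≤ q ^ 2)
    (h3 : L ≤ q ^ 2 / 2 + 0.396 * p ^ 2) : L ≤ 0.91 * p * q := by
  by_cases h4 : p ≤ 0.91 * q
  · nlinarith
  by_cases h5 : q ≤ 0.91 * p
  · nlinarith
  push Not at h4 h5
  nlinarith [mul_pos (sub_pos.2 h4) (sub_pos.2 h5)]

/-! ### Autocorrelation and the upper bound -/

lemma memLp_comp_add_right {E : Type*} [NormedAddCommGroup E] {f : ℝ → E} {p : ENNReal}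
    (hf : MemLp f p volume) (t : ℝ) : MemLp (fun x => f (x + t)) p volume :=
  hf.comp_measurePreserving (measurePreserving_add_right volume t)

lemma integrable_mul_comp_add_right {f : ℝ → ℝ} (hf : MemLp f 2 volume) (t : ℝ) :
    Integrable (fun x => f x * f (x + t)) :=
  hf.integrable_mul (memLp_comp_add_right hf t)

/-- The autocorrelation of `f` is the cosine transform of its power spectrum. -/
lemma integral_mul_comp_add_right_eq {f : ℝ → ℝ} (h1 : Integrable f) (h2 : MemLp f 2 volume)
    (t : ℝ) :
    ∫ x, f x * f (x + t) =
      ∫ ξ, ‖𝓕 (fun x => (f x : ℂ)) ξ‖ ^ 2 * Real.cos (2 * Real.pi * ξ * t) := by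
  set F : ℝ → ℂ := fun x => (f x : ℂ) with hF
  have hF1 : Integrable F := h1.ofReal
  have hF2 : MemLp F 2 volume := h2.ofReal
  have key := integral_conj_mul_fourier hF1 hF2 (hF1.comp_add_right t)
    (memLp_comp_add_right hF2 t)
  have hint : Integrable fun ξ => starRingEnd ℂ (𝓕 F ξ) * 𝓕 (fun x => F (x + t)) ξ :=
    (memLp_two_fourier hF1 hF2).star.integrable_mul
      (memLp_two_fourier (hF1.comp_add_right t) (memLp_comp_add_right hF2 t))
  have hr : ∫ x, starRingEnd ℂ (F x) * F (x + t) = ((∫ x, f x * f (x + t) : ℝ) : ℂ) := by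
    rw [← integral_complex_ofReal]
    simp [hF]
  rw [hr] at key
  have := congrArg Complex.re key
  rw [Complex.ofReal_re] at this
  rw [← this, ← RCLike.re_eq_complex_re, ← integral_re hint]
  refine integral_congr_ae (Filter.Eventually.of_forall fun ξ => ?_)
  change (starRingEnd ℂ (𝓕 F ξ) * 𝓕 (fun x => F (x + t)) ξ).re = _
  rw [fourier_comp_add_right, mul_left_comm, ← Complex.normSq_eq_conj_mul_self,
    Complex.re_mul_ofReal, Complex.normSq_eq_norm_sq, mul_comm]
  congr 1
  rw [show (2 * Real.pi * t * ξ * Complex.I : ℂ) = ((2 * Real.pi * ξ * t : ℝ) : ℂ) * Complex.I by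
    push_cast; ring, Complex.exp_ofReal_mul_I_re]

lemma integrable_power_spectrum {f : ℝ → ℝ} (h1 : Integrable f) (h2 : MemLp f 2 volume) :
    Integrable fun ξ => ‖𝓕 (fun x => (f x : ℂ)) ξ‖ ^ 2 :=
  (memLp_two_fourier h1.ofReal h2.ofReal).integrable_norm_pow (by norm_num)

lemma integral_power_spectrum {f : ℝ → ℝ} (h1 : Integrable f) (h2 : MemLp f 2 volume) :
    ∫ ξ, ‖𝓕 (fun x => (f x : ℂ)) ξ‖ ^ 2 = ∫ x, f x ^ 2 := by
  have := integral_mul_comp_add_right_eq h1 h2 0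
  simpa [sq] using this.symm

/-- The shear `(x, t) ↦ (x, x + t)` preserves measure and reduces this to a product of integrable
functions. -/
lemma integrable_prod_mul_comp_add {f : ℝ → ℝ} (h1 : Integrable f) :
    Integrable (fun z : ℝ × ℝ => f z.1 * f (z.1 + z.2)) (volume.prod volume) :=
  (measurePreserving_prod_add volume volume).integrable_comp_of_integrable
    (g := fun z : ℝ × ℝ => f z.1 * f z.2) (h1.mul_prod h1)

lemma integrable_autocorrelation {f : ℝ → ℝ} (h1 : Integrable f) :
    Integrable fun t => ∫ x, f x * f (x + t) :=
  (integrable_prod_mul_comp_add h1).integral_prod_right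

lemma integral_autocorrelation {f : ℝ → ℝ} (h1 : Integrable f) :
    ∫ t, ∫ x, f x * f (x + t) = (∫ x, f x) ^ 2 := by
  rw [← integral_integral_swap (f := fun x t => f x * f (x + t)) (integrable_prod_mul_comp_add h1)]
  simp_rw [integral_const_mul, integral_add_left_eq_self f]
  rw [integral_mul_const, sq]

lemma intervalIntegral_autocorrelation_le {f : ℝ → ℝ} (h1 : Integrable f) (h0 : ∀ x, 0 ≤ f x)
    {a b : ℝ} (hab : a ≤ b) :
    ∫ t in a..b, ∫ x, f x * f (x + t) ≤ (∫ x, f x) ^ 2 := by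
  rw [← integral_autocorrelation h1, intervalIntegral.integral_of_le hab]
  exact setIntegral_le_integral (integrable_autocorrelation h1)
    (Filter.Eventually.of_forall fun t => integral_nonneg fun x => mul_nonneg (h0 _) (h0 _))

lemma integrable_prod_power_spectrum_mul_cos {W : ℝ → ℝ} (hW : Integrable W) (s : ℝ) :
    Integrable (fun z : ℝ × ℝ => W z.2 * Real.cos (2 * Real.pi * z.2 * z.1))
      ((volume.restrict (Set.uIoc (-s) s)).prod volume) := by
  have : IsFiniteMeasure (volume.restrict (Set.uIoc (-s) s)) :=
    isFiniteMeasure_restrict.2 measure_Ioc_lt_top.ne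
  have : Integrable (fun z : ℝ × ℝ => W z.2) ((volume.restrict (Set.uIoc (-s) s)).prod volume) :=
    hW.comp_snd _
  refine this.mul_bdd (c := 1) (by fun_prop) ?_
  exact Filter.Eventually.of_forall fun z => by simpa using Real.abs_cos_le_one _

lemma intervalIntegral_integral_mul_cos {W : ℝ → ℝ} (hW : Integrable W) (s : ℝ) :
    ∫ t in (-s)..s, ∫ ξ, W ξ * Real.cos (2 * Real.pi * ξ * t) =
      ∫ ξ, W ξ * ∫ t in (-s)..s, Real.cos (2 * Real.pi * ξ * t) := by
  rw [intervalIntegral_integral_swap (integrable_prod_power_spectrum_mul_cos hW s)]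
  simp_rw [intervalIntegral.integral_const_mul]

lemma integrable_mul_intervalIntegral_cos {W : ℝ → ℝ} (hW : Integrable W) (s : ℝ) :
    Integrable fun ξ => W ξ * ∫ t in (-s)..s, Real.cos (2 * Real.pi * ξ * t) := by
  refine hW.mul_bdd (c := |s - -s|) ?_ ?_
  · exact (intervalIntegral.continuous_parametric_intervalIntegral_of_continuous'
      (by fun_prop) _ _).aestronglyMeasurable
  · refine Filter.Eventually.of_forall fun ξ => ?_
    have := intervalIntegral.norm_integral_le_of_norm_le_const (a := -s) (b := s) (C := 1)
      (f := fun t => Real.cos (2 * Real.pi * ξ * t))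
      fun t _ => by simpa using Real.abs_cos_le_one _
    simpa using this

lemma intervalIntegral_half_autocorrelation_le {f : ℝ → ℝ} (h1 : Integrable f)
    (h2 : MemLp f 2 volume) :
    ∫ t in (-(1 / 2) : ℝ)..(1 / 2), ∫ x, f x * f (x + t) ≤
      (∫ x, f x ^ 2) / 2 + 0.396 * ∫ t in (-(3 / 4) : ℝ)..(3 / 4), ∫ x, f x * f (x + t) := by
  have hW := integrable_power_spectrum h1 h2
  simp_rw [integral_mul_comp_add_right_eq h1 h2]
  rw [intervalIntegral_integral_mul_cos hW, intervalIntegral_integral_mul_cos hW,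
    ← integral_power_spectrum h1 h2, ← integral_const_mul, ← integral_div,
    ← integral_add (hW.div_const _) ((integrable_mul_intervalIntegral_cos hW _).const_mul _)]
  refine integral_mono (integrable_mul_intervalIntegral_cos hW _)
    ((hW.div_const _).add ((integrable_mul_intervalIntegral_cos hW _).const_mul _)) fun ξ => ?_
  have := mul_le_mul_of_nonneg_left (integral_cos_half_le (2 * Real.pi * ξ))
    (sq_nonneg ‖𝓕 (fun x => (f x : ℂ)) ξ‖)
  simp only at *
  linarith

lemma integral_mul_comp_add_right_le {f : ℝ → ℝ} (h2 : MemLp f 2 volume) (t : ℝ) :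
    ∫ x, f x * f (x + t) ≤ ∫ x, f x ^ 2 := by
  have hi := h2.integrable_sq
  have hi' := hi.comp_add_right t
  have e : ∫ x, f (x + t) ^ 2 = ∫ x, f x ^ 2 := integral_add_right_eq_self (fun x => f x ^ 2) t
  have : ∫ x, f x * f (x + t) ≤ ∫ x, (f x ^ 2 + f (x + t) ^ 2) / 2 := by
    refine integral_mono (integrable_mul_comp_add_right h2 t) ((hi.add hi').div_const 2) fun x => ?_
    simp only
    nlinarith [sq_nonneg (f x - f (x + t))]
  rw [integral_div, integral_add hi hi', e] at this
  linarith

lemma intervalIntegral_autocorrelation_le_of_nonneg {f : ℝ → ℝ} (h1 : Integrable f)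
    (h2 : MemLp f 2 volume) (h0 : ∀ x, 0 ≤ f x) {p q : ℝ} (hp0 : 0 ≤ p) (hq0 : 0 ≤ q)
    (hp : ∫ x, f x = p) (hq : ∫ x, f x ^ 2 = q ^ 2) :
    ∫ t in (-(1 / 2) : ℝ)..(1 / 2), ∫ x, f x * f (x + t) ≤ 0.91 * p * q := by
  refine le_of_three_bounds hp0 hq0 ?_ ?_ ?_
  · rw [← hp]
    exact intervalIntegral_autocorrelation_le h1 h0 (by norm_num)
  · have := intervalIntegral.integral_mono (μ := volume) (a := -(1 / 2)) (b := 1 / 2) (by norm_num)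
      (integrable_autocorrelation h1).intervalIntegrable
      (intervalIntegrable_const (c := ∫ x, f x ^ 2)) (fun t => integral_mul_comp_add_right_le h2 t)
    rw [intervalIntegral.integral_const, hq] at this
    norm_num at this ⊢
    linarith
  · have h := intervalIntegral_half_autocorrelation_le h1 h2
    have h' := intervalIntegral_autocorrelation_le h1 h0 (a := -(3 / 4)) (b := 3 / 4) (by norm_num)
    rw [hp] at h'
    rw [hq] at h
    linarith

lemma toReal_eLpNorm_one_eq {f : ℝ → ℝ} (h1 : MemLp f 1 volume) :
    (eLpNorm f 1 volume).toReal = ∫ x, |f x| := by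
  rw [eLpNorm_one_eq_lintegral_enorm, ← integral_norm_eq_lintegral_enorm h1.1]
  rfl

lemma toReal_eLpNorm_two_sq {f : ℝ → ℝ} (h2 : MemLp f 2 volume) :
    (eLpNorm f 2 volume).toReal ^ 2 = ∫ x, f x ^ 2 := by
  have h := h2.eLpNorm_eq_integral_rpow_norm (by norm_num) (by norm_num)
  have h0 : 0 ≤ ∫ x, f x ^ 2 := integral_nonneg fun x => sq_nonneg _
  rw [h]
  simp only [ENNReal.toReal_ofNat, Real.rpow_ofNat, Real.norm_eq_abs, sq_abs]
  rw [ENNReal.toReal_ofReal (by positivity), ← Real.rpow_natCast, ← Real.rpow_mul h0]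
  norm_num

theorem intervalIntegral_autocorrelation_le_mul_eLpNorm {f : ℝ → ℝ} (h1 : MemLp f 1 volume)
    (h2 : MemLp f 2 volume) :
    ∫ t in (-(1 / 2) : ℝ)..(1 / 2), ∫ x, f x * f (x + t) ≤
      0.91 * (eLpNorm f 1 volume).toReal * (eLpNorm f 2 volume).toReal := by
  have i1 := memLp_one_iff_integrable.1 h1
  have h2' : MemLp (fun x => |f x|) 2 volume := h2.norm
  refine le_trans ?_ (intervalIntegral_autocorrelation_le_of_nonneg (f := fun x => |f x|)
    i1.abs h2' (fun x => abs_nonneg _)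
    ENNReal.toReal_nonneg ENNReal.toReal_nonneg (toReal_eLpNorm_one_eq h1).symm ?_)
  · refine intervalIntegral.integral_mono (by norm_num)
      (integrable_autocorrelation i1).intervalIntegrable
      (integrable_autocorrelation i1.abs).intervalIntegrable fun t => ?_
    refine integral_mono (integrable_mul_comp_add_right h2 t)
      (integrable_mul_comp_add_right h2' t) fun x => ?_
    simpa [abs_mul] using le_abs_self (f x * f (x + t))
  · simp only [sq_abs]
    exact (toReal_eLpNorm_two_sq h2).symm

/-! ### Box functions and the counterexample to 0.8 -/

/-- Indicator function of the interval `[-r, r]`. -/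
noncomputable def boxFun (r : ℝ) : ℝ → ℝ := (Set.Icc (-r) r).indicator 1

lemma boxFun_nonneg (r x : ℝ) : 0 ≤ boxFun r x :=
  Set.indicator_nonneg (fun _ _ => zero_le_one) x

lemma memLp_boxFun (r : ℝ) (p : ENNReal) : MemLp (boxFun r) p volume :=
  memLp_indicator_const p measurableSet_Icc (1 : ℝ) (Or.inr measure_Icc_lt_top.ne)

lemma integral_boxFun {r : ℝ} (hr : 0 ≤ r) : ∫ x, boxFun r x = 2 * r := by
  rw [boxFun, integral_indicator_one measurableSet_Icc, Real.volume_real_Icc_of_le (by linarith)]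
  ring

lemma integral_boxFun_mul_comp_add (r s t : ℝ) :
    ∫ x, boxFun r x * boxFun s (x + t) = max (min r (s - t) - max (-r) (-s - t)) 0 := by
  have : (fun x => boxFun r x * boxFun s (x + t)) =
      (Set.Icc (max (-r) (-s - t)) (min r (s - t))).indicator 1 := by
    ext x
    simp only [boxFun, Set.indicator_apply, Set.mem_Icc, Pi.one_apply, ← ite_and, mul_ite, mul_one,
      mul_zero, max_le_iff, le_min_iff]
    congr 1
    ext
    constructor
    · rintro ⟨⟨_, _⟩, _, _⟩
      refine ⟨⟨?_, ?_⟩, ?_, ?_⟩ <;> linarith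
    · rintro ⟨⟨_, _⟩, _, _⟩
      refine ⟨⟨?_, ?_⟩, ?_, ?_⟩ <;> linarith
  rw [this, integral_indicator_one measurableSet_Icc, Real.volume_real_Icc]

lemma integral_boxFun_mul {r s : ℝ} (hr : 0 ≤ r) (hs : 0 ≤ s) :
    ∫ x, boxFun r x * boxFun s x = 2 * min r s := by
  have := integral_boxFun_mul_comp_add r s 0
  simp only [add_zero, sub_zero] at this
  rw [this, max_neg_neg, max_eq_left]
  · ring
  · have := le_min hr hs
    linarith

lemma integral_max_abs_sub {a : ℝ} (h0 : 0 ≤ a) (h1 : a ≤ 1 / 2) :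
    ∫ t in (-(1 / 2) : ℝ)..(1 / 2), max (|t| - a) 0 = (1 / 2 - a) ^ 2 := by
  have hc : Continuous fun t : ℝ => max (|t| - a) 0 := by fun_prop
  have e1 : ∫ t in (0 : ℝ)..a, max (|t| - a) 0 = 0 := by
    rw [intervalIntegral.integral_congr (g := fun _ => (0 : ℝ)), intervalIntegral.integral_zero]
    intro t ht
    rw [Set.uIcc_of_le h0] at ht
    simp only [abs_of_nonneg ht.1]
    exact max_eq_right (by linarith [ht.2])
  have e2 : ∫ t in a..(1 / 2), max (|t| - a) 0 = (1 / 2 - a) ^ 2 / 2 := by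
    rw [intervalIntegral.integral_congr (g := fun t => t - a)]
    · rw [intervalIntegral.integral_sub intervalIntegral.intervalIntegrable_id
        intervalIntegrable_const, integral_id, intervalIntegral.integral_const, smul_eq_mul]
      ring
    · intro t ht
      rw [Set.uIcc_of_le h1] at ht
      simp only [abs_of_nonneg (h0.trans ht.1)]
      exact max_eq_left (by linarith [ht.1])
  have e3 : ∫ t in (0 : ℝ)..(1 / 2), max (|t| - a) 0 = (1 / 2 - a) ^ 2 / 2 := by
    rw [← intervalIntegral.integral_add_adjacent_intervals (hc.intervalIntegrable 0 a)
      (hc.intervalIntegrable a (1 / 2)), e1, e2, zero_add]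
  have e4 : ∫ t in (-(1 / 2) : ℝ)..0, max (|t| - a) 0 = (1 / 2 - a) ^ 2 / 2 := by
    have := intervalIntegral.integral_comp_neg (a := 0) (b := 1 / 2)
      (fun t : ℝ => max (|t| - a) 0)
    simp only [abs_neg, neg_zero] at this
    rw [← this, e3]
  rw [← intervalIntegral.integral_add_adjacent_intervals (hc.intervalIntegrable (-(1 / 2)) 0)
      (hc.intervalIntegrable 0 (1 / 2)), e3, e4]
  ring

lemma continuous_integral_boxFun_mul (r s : ℝ) :
    Continuous fun t => ∫ x, boxFun r x * boxFun s (x + t) := by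
  simp_rw [integral_boxFun_mul_comp_add]
  fun_prop

/-- The overlap of two centred boxes is a trapezoid in `t`: constant `2 * min r s` for `|t| ≤ |r -
s|`, then falling with slope 1. Ignoring the truncation at 0 can only lower it. -/
lemma le_intervalIntegral_boxFun {r s : ℝ} (h : |r - s| ≤ 1 / 2) :
    2 * min r s - (1 / 2 - |r - s|) ^ 2 ≤
      ∫ t in (-(1 / 2) : ℝ)..(1 / 2), ∫ x, boxFun r x * boxFun s (x + t) := by
  have hc : Continuous fun t : ℝ => max (|t| - |r - s|) 0 := by fun_prop
  have e : ∫ t in (-(1 / 2) : ℝ)..(1 / 2), (2 * min r s - max (|t| - |r - s|) 0) =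
      2 * min r s - (1 / 2 - |r - s|) ^ 2 := by
    rw [intervalIntegral.integral_sub intervalIntegrable_const (hc.intervalIntegrable _ _),
      integral_max_abs_sub (abs_nonneg _) h, intervalIntegral.integral_const, smul_eq_mul]
    norm_num
  rw [← e]
  refine intervalIntegral.integral_mono (by norm_num)
    (intervalIntegrable_const.sub (hc.intervalIntegrable _ _))
    ((continuous_integral_boxFun_mul _ _).intervalIntegrable _ _) fun t => ?_
  simp only [integral_boxFun_mul_comp_add]
  refine le_max_of_le_left ?_
  grind

/-- A symmetric decreasing staircase with four steps. -/
noncomputable def staircase (x : ℝ) : ℝ := ∑ k ∈ Finset.range 4, boxFun ((k + 2 : ℝ) / 10) x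

lemma staircase_nonneg (x : ℝ) : 0 ≤ staircase x :=
  Finset.sum_nonneg fun _ _ => boxFun_nonneg _ _

lemma memLp_staircase (p : ENNReal) : MemLp staircase p volume :=
  memLp_finsetSum _ fun _ _ => memLp_boxFun _ p

lemma integral_staircase : ∫ x, staircase x = 2.8 := by
  simp only [staircase]
  rw [integral_finsetSum _ fun k _ => memLp_one_iff_integrable.1 (memLp_boxFun _ 1),
    Finset.sum_congr rfl fun (k : ℕ) _ => integral_boxFun (r := ((k + 2 : ℝ) / 10)) (by positivity)]
  norm_num [Finset.sum_range_succ]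

lemma integral_staircase_mul_comp_add (t : ℝ) :
    ∫ x, staircase x * staircase (x + t) = ∑ j ∈ Finset.range 4, ∑ k ∈ Finset.range 4,
      ∫ x, boxFun ((j + 2 : ℝ) / 10) x * boxFun ((k + 2 : ℝ) / 10) (x + t) := by
  have hi : ∀ r s : ℝ, Integrable fun x => boxFun r x * boxFun s (x + t) := fun r s =>
    (memLp_boxFun r 2).integrable_mul (memLp_comp_add_right (memLp_boxFun s 2) t)
  simp only [staircase, Finset.sum_mul_sum]
  rw [integral_finsetSum _ fun j _ => integrable_finsetSum _ fun k _ => hi _ _]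
  exact Finset.sum_congr rfl fun j _ => integral_finsetSum _ fun k _ => hi _ _

lemma integral_staircase_sq : ∫ x, staircase x ^ 2 = 9.2 := by
  have := integral_staircase_mul_comp_add 0
  simp only [add_zero] at this
  simp only [sq]
  rw [this, Finset.sum_congr rfl fun (j : ℕ) _ => Finset.sum_congr rfl fun (k : ℕ) _ =>
    integral_boxFun_mul (r := ((j + 2 : ℝ) / 10)) (s := ((k + 2 : ℝ) / 10))
      (by positivity) (by positivity)]
  simp only [Finset.sum_range_succ, Finset.sum_range_zero]
  norm_num

lemma le_intervalIntegral_staircase :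
    6.8 ≤ ∫ t in (-(1 / 2) : ℝ)..(1 / 2), ∫ x, staircase x * staircase (x + t) := by
  simp_rw [integral_staircase_mul_comp_add]
  rw [intervalIntegral.integral_finsetSum fun j _ => Continuous.intervalIntegrable
    (continuous_finsetSum _ fun k _ => continuous_integral_boxFun_mul _ _) _ _]
  rw [Finset.sum_congr rfl fun j _ => intervalIntegral.integral_finsetSum fun k _ =>
    (continuous_integral_boxFun_mul _ _).intervalIntegrable _ _]
  refine le_trans ?_ (Finset.sum_le_sum fun (j : ℕ) hj => Finset.sum_le_sum fun (k : ℕ) hk =>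
    le_intervalIntegral_boxFun (r := ((j + 2 : ℝ) / 10)) (s := ((k + 2 : ℝ) / 10)) ?_)
  · simp only [Finset.sum_range_succ, Finset.sum_range_zero]
    norm_num [abs_of_nonneg, abs_of_nonpos]
  · have hj' : (j : ℝ) ≤ 3 := by exact_mod_cast Nat.le_of_lt_succ (Finset.mem_range.1 hj)
    have hk' : (k : ℝ) ≤ 3 := by exact_mod_cast Nat.le_of_lt_succ (Finset.mem_range.1 hk)
    have := Nat.cast_nonneg (α := ℝ) j
    have := Nat.cast_nonneg (α := ℝ) k
    rw [abs_le]
    constructor <;> linarith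

lemma mul_eLpNorm_staircase_lt :
    0.8 * (eLpNorm staircase 1 volume).toReal * (eLpNorm staircase 2 volume).toReal <
      ∫ t in (-(1 / 2) : ℝ)..(1 / 2), ∫ x, staircase x * staircase (x + t) := by
  have e1 : (eLpNorm staircase 1 volume).toReal = 2.8 := by
    rw [toReal_eLpNorm_one_eq (memLp_staircase 1), ← integral_staircase]
    simp_rw [abs_of_nonneg (staircase_nonneg _)]
  have e2 := toReal_eLpNorm_two_sq (memLp_staircase 2)
  rw [integral_staircase_sq] at e2
  have h0 : 0 ≤ (eLpNorm staircase 2 volume).toReal := ENNReal.toReal_nonneg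
  rw [e1]
  have := le_intervalIntegral_staircase
  -- The margin is small: `0.8 * 2.8 * √9.2 ≈ 6.794 < 6.8`.
  nlinarith

theorem theorem1 :
    (∀ f : ℝ → ℝ, MemLp f 1 volume → MemLp f 2 volume →
      (∀ t : ℝ, Integrable (fun x : ℝ => f x * f (x + t)) volume) ∧
      IntervalIntegrable (fun t : ℝ => ∫ x : ℝ, f x * f (x + t)) volume (-(1 / 2)) (1 / 2) ∧
      (∫ t in (-(1 / 2) : ℝ)..(1 / 2), ∫ x : ℝ, f x * f (x + t)) ≤
        0.91 * (eLpNorm f 1 volume).toReal * (eLpNorm f 2 volume).toReal) ∧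
    ¬ (∀ f : ℝ → ℝ, MemLp f 1 volume → MemLp f 2 volume →
      (∫ t in (-(1 / 2) : ℝ)..(1 / 2), ∫ x : ℝ, f x * f (x + t)) ≤
        0.8 * (eLpNorm f 1 volume).toReal * (eLpNorm f 2 volume).toReal) := by
  refine ⟨fun f h1 h2 => ⟨integrable_mul_comp_add_right h2, ?_,
    intervalIntegral_autocorrelation_le_mul_eLpNorm h1 h2⟩, fun h => ?_⟩
  · exact (integrable_autocorrelation (memLp_one_iff_integrable.1 h1)).intervalIntegrable
  · exact (h staircase (memLp_staircase 1) (memLp_staircase 2)).not_gt mul_eLpNorm_staircase_lt
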